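/- Let $K$ be one of the fields $\mathbb{Q}$, $\mathbb{Q}(\sqrt{-1})$, $\mathbb{Q}(\sqrt{-2})$. Let $r_1$ and $r_2$ be the numbers of real and complex places of $K$, $D$ its discriminant, $h$ its class number, $R$ its regulator, $w$ its number of roots of unity, and put $c_K = 2^{r_1}(2\pi)^{r_2}hR/w$. For $\operatorname{Re}(s)>1$ let $\zeta_K(s)=\sum_{\mathfrak a\neq 0} N(\mathfrak a)^{-s}$ be the Dedekind zeta function of $K$ (the sum is over the nonzero ideals of the ring of integers), and let $$\Gamma_{\mathbb{R}}(s)=\pi^{-s/2}\Gamma(s/2),\qquad \Gamma_{\mathbb{C}}(s)=(2\pi)^{1-s}\Gamma(s),\qquad Z_K(s)=\Gamma_{\mathbb{R}}(s)^{r_1}\,\Gamma_{\mathbb{C}}(s)^{r_2}\,\zeta_K(s).$$ Then the function $c_K^{-1}s(s-1)|D|^{s/2}Z_K(s)$, defined for $\operatorname{Re}(s)>1$, extends to a (necessarily unique) entire function $\xi_K$, and the first two of the Li coefficients $$\lambda_n = \frac{1}{(n-1)!}\,\frac{d^n}{ds^n}\Bigl[s^{n-1}\log \xi_K(s)\Bigr]_{s=1}\qquad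 (n\ge 1),$$ where $\log$ is the principal branch, are real and strictly positive: $\lambda_1>0$ and $\lambda_2>0$. -/

import Mathlib

open NumberField NumberField.InfinitePlace NumberField.Units
open scoped IntermediateField

namespace DedekindLi

noncomputable section

/-- The complex Gamma factor `Γ_ℂ(s) = (2π)^(1-s) Γ(s)`. This is `π` times `Complex.Gammaℂ`; the real
factor `Γ_ℝ(s) = π^(-s/2) Γ(s/2)` is `Complex.Gammaℝ`. -/
def GammaC (s : ℂ) : ℂ := (2 * (Real.pi : ℂ)) ^ (1 - s) * Complex.Gamma s

/-- The constant `c_K = 2^{r₁} (2π)^{r₂} h R / w`. -/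
def cConst (K : Type*) [Field K] [NumberField K] : ℝ :=
  2 ^ nrRealPlaces K * (2 * Real.pi) ^ nrComplexPlaces K * classNumber K * regulator K /
    torsionOrder K

/-- The completed zeta function `Z_K(s) = Γ_ℝ(s)^{r₁} Γ_ℂ(s)^{r₂} ζ_K(s)`. Mathlib's `dedekindZeta`
is the Dirichlet series, so this is meaningful for `1 < re s` only, where alone it is used. -/
def completedZeta (K : Type*) [Field K] [NumberField K] (s : ℂ) : ℂ :=
  Complex.Gammaℝ s ^ nrRealPlaces K * GammaC s ^ nrComplexPlaces K * dedekindZeta K s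

/-- `ξ` is the entire function equal to `c_K⁻¹ s (s-1) |D|^{s/2} Z_K(s)` on the half plane
`1 < re s`. -/
structure IsDedekindXi (K : Type*) [Field K] [NumberField K] (ξ : ℂ → ℂ) : Prop where
  entire : Differentiable ℂ ξ
  eq_of_one_lt_re : ∀ s : ℂ, 1 < s.re →
    ξ s = (cConst K : ℂ)⁻¹ * s * (s - 1) * ((|discr K| : ℤ) : ℂ) ^ (s / 2) * completedZeta K s

/-- There is at most one such function. -/
theorem IsDedekindXi.unique {K : Type*} [Field K] [NumberField K] {ξ ξ' : ℂ → ℂ}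
    (h : IsDedekindXi K ξ) (h' : IsDedekindXi K ξ') : ξ = ξ' := by
  have hA : AnalyticOnNhd ℂ ξ Set.univ := fun z _ => h.entire.analyticAt z
  have hB : AnalyticOnNhd ℂ ξ' Set.univ := fun z _ => h'.entire.analyticAt z
  refine hA.eq_of_eventuallyEq hB (z₀ := 2) ?_
  have hU : {s : ℂ | 1 < s.re} ∈ nhds (2 : ℂ) :=
    (isOpen_lt continuous_const Complex.continuous_re).mem_nhds (by simp)
  filter_upwards [hU] with s hs
  rw [h.eq_of_one_lt_re s hs, h'.eq_of_one_lt_re s hs]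

/-- The Dedekind xi function `ξ_K`: the entire function above, which is unique. (A junk value if there
were none; that it exists has to be asserted separately.) -/
def dedekindXi (K : Type*) [Field K] [NumberField K] : ℂ → ℂ :=
  Classical.epsilon (IsDedekindXi K)

/-- The `n`-th Li coefficient of `ξ_K`, for `n ≥ 1`:
`λ_n = 1/(n-1)! · d^n/ds^n [s^(n-1) log ξ_K(s)]` at `s = 1`. As `ξ_K(1) = 1`, the principal
logarithm of `ξ_K` is holomorphic near `1`. -/
def liCoeff (K : Type*) [Field K] [NumberField K] (n : ℕ) : ℂ :=
  1 / ((n - 1).factorial : ℂ) *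
    iteratedDeriv n (fun s : ℂ => s ^ (n - 1) * Complex.log (dedekindXi K s)) 1

/-- `K = ℚ(√d)`. -/
def IsRatAdjoinSqrt (K : Type*) [Field K] [NumberField K] (d : ℤ) : Prop :=
  ∃ x : K, x ^ 2 = (d : K) ∧ ℚ⟮x⟯ = ⊤

end

end DedekindLi

/-! For these fields the completed zeta function is the Mellin transform of `f - 1`, where `f` is a
product of Jacobi theta values with `f (1/t) = t * f t`. Subtracting `1` on `t > 1` and `1/t` on `t
< 1` leaves a nonnegative kernel φ whose Mellin transform Λ₀ is entire, and ξ(s) = 1 + s(s-1)Λ₀(s).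

Write m = ∫ φ and l = ∫ φ log t over t > 0. Then ξ(1) = 1, ξ'(1) = m and ξ''(1) = 2m + 2l, so λ₁ = m
and λ₂ = 2ξ' + ξ'' - ξ'² = m(4 - m) + 2l. It remains to see 0 < m < 4 and l ≥ 0. Positivity of m
comes from f > 1, and m ≤ 3 from the decay of theta (`mass_le`). The symmetry Λ₀(s) = Λ₀(1-s) gives
l ≥ 0 (`logMass_nonneg`). All this is `xi_and_li_of_thetaKernel`.

The arithmetic input is that the unit group is finite and the class number is one, so that summing
N(x)^(-s) over nonzero integers x gives w ζ_K(s) (`hasSum_norm_cpow`). The norm forms n² and m² + d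
n² then turn this sum into the Mellin transform of theta values (`mellin_theta_ringOfIntegers`). -/

namespace DedekindLi

/-! ### Jacobi's theta function and the two families of theta kernels. -/

open HurwitzZeta Set

/-- The theta function `θ(t) = ∑_{n ∈ ℤ} exp(-π n² t)`. -/
noncomputable def theta (t : ℝ) : ℝ := evenKernel 0 t

theorem hasSum_theta {t : ℝ} (ht : 0 < t) :
    HasSum (fun n : ℤ => Real.exp (-Real.pi * (n : ℝ) ^ 2 * t)) (theta t) := by
  simpa [theta] using hasSum_int_evenKernel 0 ht

theorem continuousOn_theta : ContinuousOn theta (Ioi 0) := continuousOn_evenKernel 0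

theorem theta_one_div {t : ℝ} (ht : 0 < t) : theta (1 / t) = √t * theta t := by
  have h := evenKernel_functional_equation 0 t
  rw [← evenKernel_eq_cosKernel_of_zero, ← Real.sqrt_eq_rpow] at h
  have : √t ≠ 0 := (Real.sqrt_pos.2 ht).ne'
  rw [theta, theta, h]
  field_simp

theorem one_lt_theta {t : ℝ} (ht : 0 < t) : 1 < theta t := by
  have h := (hasSum_theta ht).summable.sum_le_tsum {0, 1} fun _ _ => (Real.exp_pos _).le
  rw [(hasSum_theta ht).tsum_eq, Finset.sum_pair zero_ne_one] at h
  simp only [Int.cast_zero, Int.cast_one] at h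
  norm_num at h
  linarith [Real.exp_pos (-(Real.pi * t))]

/-- Geometric series bound 2q/(1-q) with q = exp(-πt). The threshold 7/10 lies below 1/√2, the
smallest scaling needed; there q ≤ 1/8, and 16/7 = 2/(1 - 1/8). -/
theorem theta_sub_one_le {t : ℝ} (ht : 7 / 10 ≤ t) :
    theta t - 1 ≤ 16 / 7 * Real.exp (-Real.pi * t) := by
  have ht0 : 0 < t := by linarith
  have him : (Complex.I * t).im = t := by simp
  have h := norm_jacobiTheta_sub_one_le (τ := Complex.I * t) (by rwa [him])
  have hE : (theta t : ℂ) = jacobiTheta (Complex.I * t) := by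
    have := evenKernel_def 0 t
    rw [theta, jacobiTheta_eq_jacobiTheta₂]
    simpa using this
  rw [him, ← hE, ← Complex.ofReal_one, ← Complex.ofReal_sub, Complex.norm_real] at h
  refine (le_abs_self _).trans (h.trans ?_)
  have h8 : Real.exp (-Real.pi * t) ≤ 1 / 8 := by
    have h21 : -Real.pi * t ≤ -(2.1 : ℝ) := by nlinarith [Real.pi_gt_three]
    refine (Real.exp_le_exp.2 h21).trans ?_
    rw [Real.exp_neg, one_div]
    refine inv_anti₀ (by norm_num) ?_
    have h1 : Real.exp 2.1 = Real.exp 1 ^ 2 * Real.exp 0.1 := by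
      rw [← Real.exp_nat_mul, ← Real.exp_add]; norm_num
    have h2 := Real.exp_one_gt_d9
    have h3 := Real.add_one_le_exp (0.1 : ℝ)
    rw [h1]
    have h4 : (7.38 : ℝ) ≤ Real.exp 1 ^ 2 := by nlinarith
    nlinarith
  refine mul_le_mul_of_nonneg_right ?_ (Real.exp_pos _).le
  rw [div_le_div_iff₀ (by linarith) (by norm_num)]
  linarith

/-- A self-dual theta kernel of weight one tending to `1` at infinity, with an explicit rate. -/
structure IsThetaKernel (f : ℝ → ℝ) : Prop where
  cont : ContinuousOn f (Ioi 0)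
  inv : ∀ t, 0 < t → f (1 / t) = t * f t
  one_lt : ∀ t, 0 < t → 1 < f t
  le : ∀ t, 1 ≤ t → f t - 1 ≤ 6 * Real.exp (-2 * t)

theorem isThetaKernel_theta_sq : IsThetaKernel fun t => theta (t ^ (2 : ℝ)) where
  cont := continuousOn_theta.comp
    (fun t ht => (Real.continuousAt_rpow_const _ _ (Or.inl (ne_of_gt ht))).continuousWithinAt)
    fun t ht => Real.rpow_pos_of_pos ht _
  inv t ht := by
    rw [Real.rpow_two, Real.rpow_two, one_div, inv_pow, ← one_div, theta_one_div (by positivity),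
      Real.sqrt_sq ht.le]
  one_lt t ht := one_lt_theta (Real.rpow_pos_of_pos ht _)
  le t ht := by
    rw [Real.rpow_two]
    refine (theta_sub_one_le (by nlinarith)).trans ?_
    have : Real.exp (-Real.pi * t ^ 2) ≤ Real.exp (-2 * t) :=
      Real.exp_le_exp.2 (by nlinarith [Real.pi_gt_three])
    nlinarith [Real.exp_pos (-2 * t)]

theorem isThetaKernel_theta_mul_theta {a b : ℝ} (ha : 7 / 10 ≤ a) (hb : 7 / 10 ≤ b)
    (hab : a * b = 1) : IsThetaKernel fun t => theta (a * t) * theta (b * t) := by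
  have ha0 : 0 < a := by linarith
  have hb0 : 0 < b := by linarith
  refine ⟨?_, fun t ht => ?_, fun t ht => ?_, fun t ht => ?_⟩
  · exact (continuousOn_theta.comp (by fun_prop) fun t ht => mul_pos ha0 ht).mul
      (continuousOn_theta.comp (by fun_prop) fun t ht => mul_pos hb0 ht)
  · have h1 : a * (1 / t) = 1 / (b * t) := by field_simp; linarith
    have h2 : b * (1 / t) = 1 / (a * t) := by field_simp; linarith
    have h3 : √(b * t) * √(a * t) = t := by
      rw [← Real.sqrt_mul (by positivity), show b * t * (a * t) = t ^ 2 by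
        linear_combination t ^ 2 * hab, Real.sqrt_sq ht.le]
    rw [h1, h2, theta_one_div (by positivity), theta_one_div (by positivity)]
    linear_combination theta (b * t) * theta (a * t) * h3
  · exact one_lt_mul_of_lt_of_le (one_lt_theta (by positivity)) (one_lt_theta (by positivity)).le
  · have key : ∀ c : ℝ, 7 / 10 ≤ c → theta (c * t) - 1 ≤ 16 / 7 * Real.exp (-2 * t) := by
      intro c hc
      refine (theta_sub_one_le (by nlinarith)).trans ?_
      have : Real.exp (-Real.pi * (c * t)) ≤ Real.exp (-2 * t) := by
        refine Real.exp_le_exp.2 ?_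
        have : 2 ≤ Real.pi * c := by nlinarith [Real.pi_gt_three]
        nlinarith
      linarith
    have hE : Real.exp (-2 * t) ≤ 1 / 4 := by
      refine (Real.exp_le_exp.2 (show -2 * t ≤ -2 by linarith)).trans ?_
      rw [Real.exp_neg, one_div]
      refine inv_anti₀ (by norm_num) ?_
      rw [show (2 : ℝ) = 1 + 1 by norm_num, Real.exp_add]
      nlinarith [Real.add_one_le_exp (1 : ℝ)]
    have hE0 := Real.exp_pos (-2 * t)
    have h1 := key a ha
    have h2 := key b hb
    have h3 := one_lt_theta (show 0 < a * t by positivity)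
    have h4 := one_lt_theta (show 0 < b * t by positivity)
    -- With A, B the two excesses over 1, the excess of the product is A + B + AB, at most 16/7 · (2
    -- + 4/7) = 288/49 < 6 times exp(-2t).
    have h5 : (theta (a * t) - 1) * (theta (b * t) - 1) ≤
        16 / 7 * Real.exp (-2 * t) * (16 / 7 * (1 / 4)) :=
      mul_le_mul h1 (by linarith) (by linarith) (by positivity)
    nlinarith

end DedekindLi

/-! ### The entire function of a theta kernel and its derivatives at 1. -/

namespace DedekindLi

open Set MeasureTheory Filter Topology

namespace IsThetaKernel

variable {f : ℝ → ℝ}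

theorem isBigO_sub_one (hf : IsThetaKernel f) (r : ℝ) :
    (fun t => ((f t : ℝ) : ℂ) - 1) =O[atTop] fun t : ℝ => t ^ r := by
  have h1 : (fun t => ((f t : ℝ) : ℂ) - 1) =O[atTop] fun t : ℝ => Real.exp (-2 * t) := by
    refine Asymptotics.IsBigO.of_bound 6 ?_
    filter_upwards [eventually_ge_atTop 1] with t ht
    rw [← Complex.ofReal_one, ← Complex.ofReal_sub, Complex.norm_real, Real.norm_eq_abs,
      Real.norm_eq_abs, Real.abs_exp, abs_of_pos (by linarith [hf.one_lt t (by linarith)])]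
    exact hf.le t ht
  exact h1.trans (isLittleO_exp_neg_mul_rpow_atTop two_pos r).isBigO

/-- The functional-equation pair of a theta kernel. -/
noncomputable def pair (hf : IsThetaKernel f) : WeakFEPair ℂ where
  f t := (f t : ℂ)
  g t := (f t : ℂ)
  k := 1
  ε := 1
  f₀ := 1
  g₀ := 1
  hf_int := (Complex.continuous_ofReal.comp_continuousOn hf.cont).locallyIntegrableOn
    measurableSet_Ioi
  hg_int := (Complex.continuous_ofReal.comp_continuousOn hf.cont).locallyIntegrableOn
    measurableSet_Ioi
  hk := one_pos
  hε := one_ne_zero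
  h_feq x hx := by
    rw [hf.inv x hx, Real.rpow_one]
    simp
  hf_top := hf.isBigO_sub_one
  hg_top := hf.isBigO_sub_one

/-- The regularised kernel, whose Mellin transform is entire. -/
noncomputable def modif (f : ℝ → ℝ) (t : ℝ) : ℝ :=
  (Ioi 1).indicator (fun t => f t - 1) t + (Ioo 0 1).indicator (fun t => f t - t⁻¹) t

theorem pair_f_modif (hf : IsThetaKernel f) : hf.pair.f_modif = fun t => (modif f t : ℂ) := by
  ext t
  simp only [WeakFEPair.f_modif, pair, modif, Pi.add_apply, indicator_apply, Complex.ofReal_add,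
    Real.rpow_neg_one]
  split_ifs <;> simp

theorem modif_of_gt {t : ℝ} (ht : 1 < t) : modif f t = f t - 1 := by
  simp [modif, ht, not_lt_of_gt ht]

theorem modif_of_lt (hf : IsThetaKernel f) {t : ℝ} (h0 : 0 < t) (ht : t < 1) :
    modif f t = t⁻¹ * (f t⁻¹ - 1) := by
  have h := hf.inv t h0
  rw [one_div] at h
  rw [h, modif, indicator_of_notMem (by simp [ht.le]), indicator_of_mem (by simp [h0, ht])]
  field_simp
  ring

theorem modif_one : modif f 1 = 0 := by simp [modif]

theorem modif_nonneg (hf : IsThetaKernel f) {t : ℝ} (h0 : 0 < t) : 0 ≤ modif f t := by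
  rcases lt_trichotomy t 1 with ht | rfl | ht
  · rw [hf.modif_of_lt h0 ht]
    have := hf.one_lt t⁻¹ (inv_pos.2 h0)
    exact mul_nonneg (inv_pos.2 h0).le (by linarith)
  · rw [modif_one]
  · rw [modif_of_gt ht]
    linarith [hf.one_lt t h0]

/-- For t > 1, one factor exp(-t) of 6 exp(-2t) is at most exp(-1) ≤ 1/2. For t < 1, inversion
reduces to 6u exp(-2u) with u = 1/t > 1, which is at most 6 exp(-2) ≤ 3 exp(-1). -/
theorem modif_le (hf : IsThetaKernel f) {t : ℝ} (h0 : 0 < t) :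
    modif f t ≤ 3 * Real.exp (-t) := by
  have he : Real.exp (-1 : ℝ) ≤ 1 / 2 := by
    rw [Real.exp_neg, one_div]
    exact inv_anti₀ two_pos (by linarith [Real.add_one_le_exp (1 : ℝ)])
  have he0 := Real.exp_pos (-1 : ℝ)
  rcases lt_trichotomy t 1 with ht | rfl | ht
  · rw [hf.modif_of_lt h0 ht]
    set u := t⁻¹ with hu
    have hu1 : 1 < u := (one_lt_inv₀ h0).2 ht
    have h1 : u * Real.exp (-2 * u) ≤ Real.exp (-1) * Real.exp (-1) := by
      have h2 : u ≤ Real.exp (2 * (u - 1)) := by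
        linarith [Real.add_one_le_exp (2 * (u - 1))]
      have h3 : Real.exp (2 * (u - 1)) * Real.exp (-2 * u) = Real.exp (-1) * Real.exp (-1) := by
        rw [← Real.exp_add, ← Real.exp_add]; ring_nf
      rw [← h3]
      exact mul_le_mul_of_nonneg_right h2 (Real.exp_pos _).le
    have h4 : Real.exp (-1) ≤ Real.exp (-t) := Real.exp_le_exp.2 (by linarith)
    have h5 := mul_le_mul_of_nonneg_left (hf.le u hu1.le) (show 0 ≤ u by linarith)
    nlinarith
  · rw [modif_one]; positivity
  · rw [modif_of_gt ht]
    have h1 := hf.le t ht.le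
    have h2 : Real.exp (-2 * t) = Real.exp (-t) * Real.exp (-t) := by
      rw [← Real.exp_add]; ring_nf
    have h3 : Real.exp (-t) ≤ Real.exp (-1) := Real.exp_le_exp.2 (by linarith)
    nlinarith [Real.exp_pos (-t)]

theorem mellin_modif (hf : IsThetaKernel f) (s : ℂ) :
    MellinConvergent (fun t => (modif f t : ℂ)) s ∧
    MellinConvergent (fun t => Real.log t • (modif f t : ℂ)) s ∧
      HasDerivAt hf.pair.Λ₀ (mellin (fun t => Real.log t • (modif f t : ℂ)) s) s := by
  rw [WeakFEPair.Λ₀]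
  have hS := hf.pair.isStrongFEPair_toStrongFEPair
  have h1 := (hS.hasMellin s).1
  have htop := hS.hf_top (-(s.re + 1))
  have hbot := hS.hf_zero (-(s.re - 1))
  have h2 := mellin_hasDerivAt_of_isBigO_rpow hf.pair.hf_modif_int htop (by linarith : s.re < _)
    hbot (by linarith)
  change MellinConvergent hf.pair.f_modif s at h1
  rw [hf.pair_f_modif] at h1 h2 ⊢
  exact ⟨h1, h2⟩

/-- The total mass of the regularised kernel. -/
noncomputable def mass (f : ℝ → ℝ) : ℝ := ∫ t in Ioi (0 : ℝ), modif f t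

/-- The logarithmic moment of the regularised kernel. -/
noncomputable def logMass (f : ℝ → ℝ) : ℝ := ∫ t in Ioi (0 : ℝ), Real.log t * modif f t

theorem integrableOn_modif (hf : IsThetaKernel f) : IntegrableOn (modif f) (Ioi 0) := by
  have h := (hf.mellin_modif 1).1
  simp only [MellinConvergent, sub_self, Complex.cpow_zero, one_smul] at h
  simpa [IntegrableOn] using h.re

theorem Λ₀_one (hf : IsThetaKernel f) : hf.pair.Λ₀ 1 = (mass f : ℂ) := by
  rw [WeakFEPair.Λ₀, hf.pair_f_modif, mellin, mass]
  simp only [sub_self, Complex.cpow_zero, one_smul]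
  exact integral_ofReal

theorem mass_pos (hf : IsThetaKernel f) : 0 < mass f := by
  have hnn : ∀ t ∈ Ioi (0 : ℝ), 0 ≤ modif f t := fun t ht => hf.modif_nonneg ht
  rw [mass, setIntegral_pos_iff_support_of_nonneg_ae
    ((ae_restrict_iff' measurableSet_Ioi).2 (Eventually.of_forall hnn)) hf.integrableOn_modif]
  have hsub : Ioi (1 : ℝ) ⊆ Function.support (modif f) ∩ Ioi 0 := by
    intro t ht
    have h0 : (0 : ℝ) < t := zero_lt_one.trans ht
    refine ⟨?_, h0⟩
    rw [Function.mem_support, modif_of_gt ht]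
    linarith [hf.one_lt t h0]
  refine lt_of_lt_of_le ?_ (measure_mono hsub)
  simp

theorem mass_le (hf : IsThetaKernel f) : mass f ≤ 3 := by
  have h : ∫ t in Ioi (0 : ℝ), 3 * Real.exp (-t) = 3 := by
    rw [integral_const_mul, integral_exp_neg_Ioi_zero, mul_one]
  rw [← h, mass]
  exact setIntegral_mono_on hf.integrableOn_modif
    ((integrableOn_exp_neg_Ioi 0).const_mul 3) measurableSet_Ioi fun t ht => hf.modif_le ht

theorem integrableOn_log_mul_modif (hf : IsThetaKernel f) :
    IntegrableOn (fun t => Real.log t * modif f t) (Ioi 0) := by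
  have h := (hf.mellin_modif 1).2.1
  simp only [MellinConvergent, sub_self, Complex.cpow_zero, one_smul] at h
  simpa [IntegrableOn] using h.re

theorem hasDerivAt_Λ₀_one (hf : IsThetaKernel f) :
    HasDerivAt hf.pair.Λ₀ (logMass f : ℂ) 1 := by
  convert (hf.mellin_modif 1).2.2 using 1
  rw [mellin, logMass]
  refine integral_ofReal.symm.trans ?_
  simp

theorem Λ₀_one_sub (hf : IsThetaKernel f) (s : ℂ) : hf.pair.Λ₀ (1 - s) = hf.pair.Λ₀ s := by
  have h := hf.pair.functional_equation₀ s
  have h1 : ((hf.pair.k : ℝ) : ℂ) = 1 := Complex.ofReal_one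
  have h2 : hf.pair.symm.Λ₀ s = hf.pair.Λ₀ s := by
    simp [WeakFEPair.Λ₀, WeakFEPair.f_modif, WeakFEPair.symm, pair]
  rw [h1, h2] at h
  rw [h]
  exact one_smul ℂ _

/-- Differentiating Λ₀(1-s) = Λ₀(s) gives Λ₀'(0) = -Λ₀'(1). As a Mellin integral, Λ₀'(0) has the
extra weight 1/t, which can only lower log t times a nonnegative function. Hence -l ≤ l. -/
theorem logMass_nonneg (hf : IsThetaKernel f) : 0 ≤ logMass f := by
  have h0 := (hf.mellin_modif 0).2
  have hint : ∀ t ∈ Ioi (0 : ℝ), (t : ℂ) ^ ((0 : ℂ) - 1) • Real.log t • (modif f t : ℂ) =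
      ((t⁻¹ * (Real.log t * modif f t) : ℝ) : ℂ) := fun t _ => by
    simp [Complex.cpow_neg_one]
  have hI : IntegrableOn (fun t => t⁻¹ * (Real.log t * modif f t)) (Ioi 0) := by
    have h := h0.1
    rw [MellinConvergent, integrableOn_congr_fun hint measurableSet_Ioi] at h
    simpa [IntegrableOn] using h.re
  have hE : mellin (fun t => Real.log t • (modif f t : ℂ)) 0 =
      ((∫ t in Ioi (0 : ℝ), t⁻¹ * (Real.log t * modif f t) : ℝ) : ℂ) := by
    rw [mellin, setIntegral_congr_fun measurableSet_Ioi hint]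
    exact integral_ofReal
  have hd : HasDerivAt hf.pair.Λ₀ (-(logMass f : ℂ)) 0 := by
    have h1 : HasDerivAt hf.pair.Λ₀ (logMass f : ℂ) (1 - 0) := by
      rw [sub_zero]; exact hf.hasDerivAt_Λ₀_one
    have h2 := h1.comp_const_sub 1 0
    exact h2.congr_of_eventuallyEq (Eventually.of_forall fun s => (hf.Λ₀_one_sub s).symm)
  have heq := hd.unique h0.2
  rw [hE, ← Complex.ofReal_neg, Complex.ofReal_inj] at heq
  have hle : ∫ t in Ioi (0 : ℝ), t⁻¹ * (Real.log t * modif f t) ≤ logMass f := by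
    refine setIntegral_mono_on hI hf.integrableOn_log_mul_modif measurableSet_Ioi fun t ht => ?_
    have hm := hf.modif_nonneg ht
    rw [← mul_assoc]
    refine mul_le_mul_of_nonneg_right ?_ hm
    rcases le_total t 1 with h | h
    · nlinarith [Real.log_nonpos (le_of_lt ht) h, (one_le_inv₀ ht).2 h]
    · nlinarith [Real.log_nonneg h, inv_le_one_of_one_le₀ h]
  linarith

/-- The entire function attached to a theta kernel. -/
noncomputable def xi (hf : IsThetaKernel f) (s : ℂ) : ℂ := 1 + s * (s - 1) * hf.pair.Λ₀ s

theorem differentiable_xi (hf : IsThetaKernel f) : Differentiable ℂ hf.xi := by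
  have := hf.pair.differentiable_Λ₀
  unfold xi
  fun_prop

/-- Λ₀ exceeds the Mellin transform by 1/s + 1/(1-s), and s(s-1) times this is -1, cancelling the
constant term of ξ. -/
theorem xi_eq_mellin (hf : IsThetaKernel f) {s : ℂ} (hs : 1 < s.re) :
    hf.xi s = s * (s - 1) * mellin (fun t => (f t : ℂ) - 1) s := by
  have hs0 : s ≠ 0 := by rintro rfl; norm_num at hs
  have hs1 : 1 - s ≠ 0 := by
    intro h
    rw [← sub_eq_zero.1 h] at hs
    norm_num at hs
  have h := (hf.pair.hasMellin (s := s) hs).2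
  have hΛ := hf.pair.Λ₀_eq s
  rw [← h] at hΛ
  have h' : hf.pair.Λ₀ s = mellin (fun t => (f t : ℂ) - 1) s + 1 / s + 1 / (1 - s) := by
    rw [hΛ]
    simp [pair]
  rw [xi, h']
  field_simp
  ring

theorem xi_one (hf : IsThetaKernel f) : hf.xi 1 = 1 := by simp [xi]

theorem hasDerivAt_xi (hf : IsThetaKernel f) (s : ℂ) :
    HasDerivAt hf.xi ((2 * s - 1) * hf.pair.Λ₀ s + s * (s - 1) * deriv hf.pair.Λ₀ s) s := by
  have h := (hf.pair.differentiable_Λ₀ s).hasDerivAt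
  have h2 := ((((hasDerivAt_id s).mul ((hasDerivAt_id s).sub_const 1)).mul h).const_add 1)
  refine h2.congr_deriv ?_
  simp only [id, Pi.mul_apply]
  ring

theorem deriv_xi_one (hf : IsThetaKernel f) : deriv hf.xi 1 = (mass f : ℂ) := by
  rw [(hf.hasDerivAt_xi 1).deriv, hf.Λ₀_one]
  ring

theorem deriv_deriv_xi_one (hf : IsThetaKernel f) :
    deriv (deriv hf.xi) 1 = ((2 * mass f + 2 * logMass f : ℝ) : ℂ) := by
  have hd : deriv hf.xi = fun s =>
      (2 * s - 1) * hf.pair.Λ₀ s + s * (s - 1) * deriv hf.pair.Λ₀ s :=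
    funext fun s => (hf.hasDerivAt_xi s).deriv
  have h1 := hf.hasDerivAt_Λ₀_one
  have h2 : HasDerivAt (deriv hf.pair.Λ₀) (deriv (deriv hf.pair.Λ₀) 1) 1 :=
    ((hf.pair.differentiable_Λ₀.contDiff (n := 2)).differentiable_deriv_two 1).hasDerivAt
  have hid := hasDerivAt_id (1 : ℂ)
  have h3 := (((hid.const_mul 2).sub_const 1).mul h1).add ((hid.mul (hid.sub_const 1)).mul h2)
  rw [hd]
  refine (h3.congr_deriv ?_).deriv
  simp [h1.deriv, hf.Λ₀_one]
  ring

end IsThetaKernel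

/-! ### Li coefficients and their positivity for theta kernels. -/

/-- The first two Li coefficients in terms of derivatives at `1`. -/
theorem liCoeff_one_eq {ξ : ℂ → ℂ} (hξ : Differentiable ℂ ξ) (h1 : ξ 1 = 1) :
    iteratedDeriv 1 (fun s : ℂ => s ^ (1 - 1) * Complex.log (ξ s)) 1 = deriv ξ 1 := by
  have hd := ((hξ 1).hasDerivAt).clog (by rw [h1]; exact Complex.one_mem_slitPlane)
  simp [iteratedDeriv_one, hd.deriv, h1]

theorem liCoeff_two_eq {ξ : ℂ → ℂ} (hξ : Differentiable ℂ ξ) (h1 : ξ 1 = 1) :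
    iteratedDeriv 2 (fun s : ℂ => s ^ (2 - 1) * Complex.log (ξ s)) 1 =
      2 * deriv ξ 1 + deriv (deriv ξ) 1 - deriv ξ 1 ^ 2 := by
  have hmem : ∀ᶠ s in 𝓝 (1 : ℂ), ξ s ∈ Complex.slitPlane :=
    hξ.continuous.continuousAt.eventually
      (Complex.isOpen_slitPlane.mem_nhds (by rw [h1]; exact Complex.one_mem_slitPlane))
  have hev : deriv (fun s : ℂ => s ^ (2 - 1) * Complex.log (ξ s)) =ᶠ[𝓝 1]
      fun s => Complex.log (ξ s) + s * (deriv ξ s / ξ s) := by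
    filter_upwards [hmem] with s hs
    have hd := (hasDerivAt_id s).mul ((hξ s).hasDerivAt.clog hs)
    have he : (fun s : ℂ => s ^ (2 - 1) * Complex.log (ξ s)) =
        id * fun s => Complex.log (ξ s) := by ext; simp
    rw [he, hd.deriv]
    simp
  rw [iteratedDeriv_succ, iteratedDeriv_one, hev.deriv_eq]
  have h2 : HasDerivAt (deriv ξ) (deriv (deriv ξ) 1) 1 :=
    ((hξ.contDiff (n := 2)).differentiable_deriv_two 1).hasDerivAt
  have h0 := (hξ 1).hasDerivAt
  have h3 := (h0.clog (by rw [h1]; exact Complex.one_mem_slitPlane)).add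
    ((hasDerivAt_id (1 : ℂ)).mul (h2.div h0 (by rw [h1]; exact one_ne_zero)))
  refine (h3.congr_deriv ?_).deriv
  simp [h1]
  ring

/-- If `ξ_K` comes from a theta kernel then it exists and its first two Li coefficients are
positive. -/
theorem xi_and_li_of_thetaKernel {K : Type*} [Field K] [NumberField K] {f : ℝ → ℝ}
    (hf : IsThetaKernel f)
    (hK : ∀ s : ℂ, 1 < s.re → (cConst K : ℂ)⁻¹ * ((|discr K| : ℤ) : ℂ) ^ (s / 2) *
      completedZeta K s = mellin (fun t => (f t : ℂ) - 1) s) :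
    IsDedekindXi K (dedekindXi K) ∧
      ((liCoeff K 1).im = 0 ∧ 0 < (liCoeff K 1).re) ∧
      ((liCoeff K 2).im = 0 ∧ 0 < (liCoeff K 2).re) := by
  have hxi : IsDedekindXi K hf.xi :=
    ⟨hf.differentiable_xi, fun s hs => by rw [hf.xi_eq_mellin hs, ← hK s hs]; ring⟩
  have hded : IsDedekindXi K (dedekindXi K) := Classical.epsilon_spec ⟨hf.xi, hxi⟩
  have hE : dedekindXi K = hf.xi := hded.unique hxi
  have hm := hf.mass_pos
  have hm' := hf.mass_le
  have hl := hf.logMass_nonneg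
  have h1 : liCoeff K 1 = (IsThetaKernel.mass f : ℂ) := by
    rw [liCoeff, hE, liCoeff_one_eq hf.differentiable_xi hf.xi_one, hf.deriv_xi_one]
    simp
  have h2 : liCoeff K 2 = ((4 * IsThetaKernel.mass f + 2 * IsThetaKernel.logMass f -
      IsThetaKernel.mass f ^ 2 : ℝ) : ℂ) := by
    rw [liCoeff, hE, liCoeff_two_eq hf.differentiable_xi hf.xi_one, hf.deriv_xi_one,
      hf.deriv_deriv_xi_one]
    push_cast
    simp
    ring
  refine ⟨hded, ?_, ?_⟩
  · rw [h1]
    exact ⟨Complex.ofReal_im _, by rwa [Complex.ofReal_re]⟩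
  · rw [h2]
    refine ⟨Complex.ofReal_im _, ?_⟩
    rw [Complex.ofReal_re]
    -- The value is m(4 - m) + 2l with 0 < m ≤ 3 and l ≥ 0.
    nlinarith

end DedekindLi

/-! ### From ideals to elements: unit rank zero and class number one. -/

namespace DedekindLi

section SumOverIntegers

variable {K : Type*} [Field K] [NumberField K]

theorem torsion_eq_top_of_rank_eq_zero (h : rank K = 0) : torsion K = ⊤ := by
  have : IsEmpty (Fin (rank K)) := by rw [h]; infer_instance
  rw [← closure_fundSystem_sup_torsion_eq_top, Set.range_eq_empty, Subgroup.closure_empty,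
    bot_sup_eq]

theorem card_units_of_rank_eq_zero (h : rank K = 0) : Nat.card (𝓞 K)ˣ = torsionOrder K := by
  rw [torsionOrder, torsion_eq_top_of_rank_eq_zero h]
  exact (Nat.card_congr Subgroup.topEquiv.toEquiv).symm

theorem finite_units_of_rank_eq_zero (h : rank K = 0) : Finite (𝓞 K)ˣ :=
  Nat.finite_of_card_ne_zero (by rw [card_units_of_rank_eq_zero h]; exact torsionOrder_ne_zero K)

theorem regulator_eq_one_of_rank_eq_zero (h : rank K = 0) : regulator K = 1 := by
  classical
  have : IsEmpty (Fin (rank K)) := by rw [h]; infer_instance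
  have : IsEmpty {w : InfinitePlace K // w ≠ dirichletUnitTheorem.w₀} :=
    (equivFinRank K).symm.isEmpty
  rw [regulator_eq_det', Matrix.det_isEmpty, abs_one]

/-- In a principal ideal domain, an element of norm `n ≠ 0` is a pair of an ideal of norm `n` and
a unit. -/
noncomputable def normFiberEquiv [IsPrincipalIdealRing (𝓞 K)] {n : ℕ} (hn : n ≠ 0) :
    {I : Ideal (𝓞 K) // Ideal.absNorm I = n} × (𝓞 K)ˣ ≃
      {x : 𝓞 K // Ideal.absNorm (Ideal.span {x}) = n} := by
  let g : Ideal (𝓞 K) → 𝓞 K := fun I => Submodule.IsPrincipal.generator I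
  have hg : ∀ I : Ideal (𝓞 K), Ideal.span {g I} = I := fun I => Ideal.span_singleton_generator I
  have hspan : ∀ (I : Ideal (𝓞 K)) (u : (𝓞 K)ˣ), Ideal.span {g I * u} = I := fun I u => by
    rw [Ideal.span_singleton_mul_right_unit u.isUnit, hg]
  refine Equiv.ofBijective (fun p => ⟨g p.1 * p.2, by rw [hspan]; exact p.1.2⟩) ⟨?_, ?_⟩
  · rintro ⟨⟨I, hI⟩, u⟩ ⟨⟨J, hJ⟩, v⟩ h
    have h' : g I * u = g J * v := congrArg Subtype.val h
    have hIJ : I = J := by rw [← hspan I u, h', hspan]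
    subst hIJ
    have h0 : g I ≠ 0 := by
      intro h0
      have := hg I
      rw [h0, Ideal.span_singleton_zero] at this
      rw [← this, Ideal.absNorm_bot] at hI
      exact hn hI.symm
    simp [Units.ext (mul_left_cancel₀ h0 h')]
  · rintro ⟨x, hx⟩
    obtain ⟨u, hu⟩ := Ideal.span_singleton_eq_span_singleton.1 (hg (Ideal.span {x}))
    exact ⟨⟨⟨Ideal.span {x}, hx⟩, u⟩, Subtype.ext hu⟩

theorem card_normFiber [IsPrincipalIdealRing (𝓞 K)] (hr : rank K = 0) {n : ℕ} (hn : n ≠ 0) :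
    Nat.card {x : 𝓞 K // Ideal.absNorm (Ideal.span {x}) = n} =
      torsionOrder K * Nat.card {I : Ideal (𝓞 K) // Ideal.absNorm I = n} := by
  rw [← Nat.card_congr (normFiberEquiv hn), Nat.card_prod, card_units_of_rank_eq_zero hr, mul_comm]

theorem finite_normFiber [IsPrincipalIdealRing (𝓞 K)] (hr : rank K = 0) (n : ℕ) :
    Finite {x : 𝓞 K // Ideal.absNorm (Ideal.span {x}) = n} := by
  rcases eq_or_ne n 0 with rfl | hn
  · have : Subsingleton {x : 𝓞 K // Ideal.absNorm (Ideal.span {x}) = 0} := by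
      refine ⟨fun x y => Subtype.ext ?_⟩
      have h := x.2
      have h' := y.2
      rw [Ideal.absNorm_eq_zero_iff, Ideal.span_singleton_eq_bot] at h h'
      rw [h, h']
    infer_instance
  · have := finite_units_of_rank_eq_zero hr
    have : Finite {I : Ideal (𝓞 K) // Ideal.absNorm I = n} :=
      Ideal.finite_setOfPred_absNorm_eq n
    exact Finite.of_equiv _ (normFiberEquiv hn)

/-- The number of ideals of norm at most n is asymptotic to a constant times n, so the partial sums
of the coefficients are O(n). -/
theorem lseriesSummable_idealCount {s : ℂ} (hs : 1 < s.re) :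
    LSeriesSummable (fun n => (Nat.card {I : Ideal (𝓞 K) // Ideal.absNorm I = n} : ℂ)) s := by
  have h := LSeriesSummable_of_sum_norm_bigO_and_nonneg (r := 1) (s := s)
    (f := fun n => (Nat.card {I : Ideal (𝓞 K) // Ideal.absNorm I = n} : ℝ)) ?_
    (fun _ => Nat.cast_nonneg _) zero_le_one hs
  · simpa using h
  have hlim : Filter.Tendsto (fun n : ℕ =>
      (∑ k ∈ Finset.Icc 1 n, (Nat.card {I : Ideal (𝓞 K) // Ideal.absNorm I = k} : ℝ)) / n)
      Filter.atTop (nhds (dedekindZeta_residue K)) := by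
    refine ((Ideal.tendsto_norm_le_div_atTop₀ K).comp tendsto_natCast_atTop_atTop).congr fun n ↦ ?_
    simp only [Function.comp_apply, Nat.cast_le, ← Nat.cast_sum]
    congr
    -- The added 1 counts the zero ideal, the only ideal of norm 0.
    rw [← add_left_inj 1, ← Ideal.card_norm_le_eq_card_norm_le_add_one,
      show Finset.Icc 1 n = Finset.Ioc 0 n from Finset.Icc_succ_left_eq_Ioc _ _,
      show 1 = Nat.card {I : Ideal (𝓞 K) // Ideal.absNorm I = 0} by
        simp [Ideal.absNorm_eq_zero_iff],
      Finset.sum_Ioc_add_eq_sum_Icc (n.zero_le),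
      ← Finset.card_preimage_eq_sum_card_image_eq
        (fun k _ ↦ Ideal.finite_setOfPred_absNorm_eq k)]
    simp [Set.coe_eq_subtype]
  simp_rw [Real.rpow_one]
  refine Asymptotics.isBigO_of_div_tendsto_nhds ?_ _ hlim
  filter_upwards [Filter.eventually_ne_atTop 0] with n hn h
  exact absurd (Nat.cast_eq_zero.1 h) hn

/-- Group the integers by norm: each nonzero ideal has exactly w generators. -/
theorem hasSum_norm_cpow [IsPrincipalIdealRing (𝓞 K)] (hr : rank K = 0) {s : ℂ} (hs : 1 < s.re) :
    HasSum (fun x : 𝓞 K => ((Ideal.absNorm (Ideal.span {x}) : ℕ) : ℂ) ^ (-s))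
      (torsionOrder K * dedekindZeta K s) := by
  have hs0 : s ≠ 0 := by rintro rfl; norm_num at hs
  set a : ℕ → ℂ := fun n => (Nat.card {I : Ideal (𝓞 K) // Ideal.absNorm I = n} : ℂ) with ha
  let N : 𝓞 K → ℕ := fun x => Ideal.absNorm (Ideal.span {x})
  have hfin : ∀ n, Finite {x // N x = n} := finite_normFiber hr
  have hterm : ∀ n : ℕ, (Nat.card {x // N x = n} : ℂ) * (n : ℂ) ^ (-s) =
      torsionOrder K * LSeries.term a s n := by
    intro n
    rcases eq_or_ne n 0 with rfl | hn
    -- The element 0 contributes nothing, since `0 ^ (-s) = 0` for s ≠ 0.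
    · simp [hs0]
    · rw [LSeries.term_of_ne_zero hn, card_normFiber hr hn, Complex.cpow_neg]
      push_cast
      ring
  have hL : Summable fun n : ℕ => LSeries.term a s n := lseriesSummable_idealCount hs
  let e := Equiv.sigmaFiberEquiv N
  have he : ∀ n (c : {x // N x = n}), N (e ⟨n, c⟩) = n := fun n c => c.2
  have hfib : ∀ n, HasSum (fun c : {x // N x = n} => ((N (e ⟨n, c⟩) : ℕ) : ℂ) ^ (-s))
      (torsionOrder K * LSeries.term a s n) := by
    intro n
    have := Fintype.ofFinite {x // N x = n}
    simp_rw [he]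
    have h := hasSum_fintype fun _ : {x // N x = n} => (n : ℂ) ^ (-s)
    rwa [Finset.sum_const, nsmul_eq_mul, Finset.card_univ, ← Nat.card_eq_fintype_card, hterm] at h
  have hsum : Summable fun p : Σ n, {x // N x = n} => ((N (e p) : ℕ) : ℂ) ^ (-s) := by
    refine Summable.of_norm ((summable_sigma_of_nonneg fun _ => norm_nonneg _).2 ⟨fun n => ?_, ?_⟩)
    · have := Fintype.ofFinite {x // N x = n}
      exact (hasSum_fintype _).summable
    · refine (hL.norm.mul_left (torsionOrder K : ℝ)).congr fun n => ?_
      have := Fintype.ofFinite {x // N x = n}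
      simp_rw [he]
      rw [tsum_fintype, Finset.sum_const, nsmul_eq_mul, Finset.card_univ, ← Nat.card_eq_fintype_card]
      have := congrArg norm (hterm n)
      simp only [norm_mul, Complex.norm_natCast] at this
      exact this.symm
  rw [← e.hasSum_iff]
  have h1 := hsum.hasSum.sigma hfib
  have h2 : HasSum (fun n => torsionOrder K * LSeries.term a s n)
      (torsionOrder K * dedekindZeta K s) := hL.hasSum.mul_left _
  rw [← h1.unique h2]
  exact hsum.hasSum

end SumOverIntegers

end DedekindLi

/-! ### Theta series over the ring of integers as Mellin kernels. -/

namespace DedekindLi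

section FieldsOfUnitRankZero

variable {K : Type*} [Field K] [NumberField K]

/-- The Mellin transform of a theta series over the ring of integers. -/
theorem mellin_theta_ringOfIntegers [IsPrincipalIdealRing (𝓞 K)] (hr : rank K = 0)
    {f : ℝ → ℝ} {c : ℝ} (hc : 0 < c) {m : ℕ} (hm : m ≠ 0)
    (hf : ∀ t : ℝ, 0 < t → HasSum (fun x : 𝓞 K =>
      Real.exp (-Real.pi * ((Ideal.absNorm (Ideal.span {x}) : ℝ) ^ m / c) * t)) (f t))
    {s : ℂ} (hs : 1 < s.re) :
    mellin (fun t => (f t : ℂ) - 1) (s / m) =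
      (Real.pi : ℂ) ^ (-(s / m)) * Complex.Gamma (s / m) * (c : ℂ) ^ (s / m) *
        (torsionOrder K * dedekindZeta K s) := by
  classical
  have hm' : (0 : ℝ) < m := Nat.cast_pos.2 (Nat.pos_of_ne_zero hm)
  have hσ : 0 < (s / m).re := by
    rw [← Complex.ofReal_natCast, Complex.div_ofReal_re]
    exact div_pos (by linarith) hm'
  set σ : ℂ := s / m with hσ_def
  have hmσ : (m : ℂ) * σ = s := mul_div_cancel₀ _ (Nat.cast_ne_zero.2 hm)
  set N : 𝓞 K → ℕ := fun x => Ideal.absNorm (Ideal.span {x}) with hN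
  have hN0 : ∀ x, N x = 0 ↔ x = 0 := fun x => by
    rw [hN]
    simp only [Ideal.absNorm_eq_zero_iff, Ideal.span_singleton_eq_bot]
  have hp0 : ∀ x, (N x : ℝ) ^ m / c = 0 ↔ x = 0 := fun x => by
    simp [hc.ne', hm, hN0]
  have hpow : ∀ x, (1 : ℂ) / (((N x : ℝ) ^ m / c : ℝ) : ℂ) ^ σ = (c : ℂ) ^ σ * (N x : ℂ) ^ (-s) := by
    intro x
    rw [div_eq_mul_inv ((N x : ℝ) ^ m) c, Complex.ofReal_mul,
      Complex.mul_cpow_ofReal_nonneg (by positivity) (by positivity), Complex.ofReal_inv,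
      Complex.inv_cpow _ _ (by rw [Complex.arg_ofReal_of_nonneg hc.le]; exact Real.pi_pos.ne),
      Complex.ofReal_pow, Complex.ofReal_natCast, ← Complex.natCast_cpow_natCast_mul, hmσ,
      Complex.cpow_neg]
    simp [mul_comm]
  have hS := hasSum_norm_cpow hr hs
  have : Countable (𝓞 K) := (RingOfIntegers.basis K).equivFun.injective.countable
  have key := hasSum_mellin_pi_mul₀ (a := fun _ : 𝓞 K => (1 : ℂ))
    (p := fun x => (N x : ℝ) ^ m / c) (F := fun t => (f t : ℂ) - 1) (s := σ)
    (fun x => by positivity) hσ (fun t ht => ?_) ?_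
  · refine key.unique ?_
    convert! hS.mul_left ((Real.pi : ℂ) ^ (-σ) * Complex.Gamma σ * (c : ℂ) ^ σ) using 2 with x
    rw [mul_div_assoc, hpow]
    ring
  · have h := (hasSum_ite_sub_hasSum (hf t ht) 0)
    simp_rw [hp0]
    rw [← Complex.hasSum_ofReal] at h
    convert! h using 2 with x
    · split_ifs <;> simp [hN]
    · simp [hm]
  · refine ((hS.summable.norm.mul_left ‖(c : ℂ) ^ σ‖)).congr fun x => ?_
    rw [← norm_mul, ← hpow, norm_div, Complex.norm_cpow_eq_rpow_re_of_nonneg (by positivity) hσ.ne']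

theorem rank_eq_zero_of_card (h : nrRealPlaces K + nrComplexPlaces K = 1) : rank K = 0 := by
  rw [rank, card_eq_nrRealPlaces_add_nrComplexPlaces, h]

end FieldsOfUnitRankZero

/-! ### The rational field. -/

section Rational

variable {K : Type*} [Field K] [NumberField K]

theorem absNorm_span_of_equiv_int (e : 𝓞 K ≃+* ℤ) (x : 𝓞 K) :
    Ideal.absNorm (Ideal.span {x}) = (e x).natAbs := by
  rw [Ideal.absNorm_span_singleton, ← Algebra.norm_eq_of_algEquiv e.toIntAlgEquiv]
  simp

theorem xi_and_li_of_equiv_rat (e : K ≃+* ℚ) :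
    IsDedekindXi K (dedekindXi K) ∧
      ((liCoeff K 1).im = 0 ∧ 0 < (liCoeff K 1).re) ∧
      ((liCoeff K 2).im = 0 ∧ 0 < (liCoeff K 2).re) := by
  refine xi_and_li_of_thetaKernel isThetaKernel_theta_sq fun s hs => ?_
  have ψ : 𝓞 K ≃+* ℤ := (RingOfIntegers.mapRingEquiv e).trans Rat.ringOfIntegersEquiv
  have hfin : Module.finrank ℚ K = 1 := by
    rw [(e.toRatAlgEquiv).toLinearEquiv.finrank_eq, Module.finrank_self]
  have hr1 := nrRealPlaces_eq_one_of_finrank_eq_one hfin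
  have hr2 := nrComplexPlaces_eq_zero_of_finrank_eq_one hfin
  have hr : rank K = 0 := rank_eq_zero_of_card (by rw [hr1, hr2])
  have hpid : IsPrincipalIdealRing (𝓞 K) :=
    IsPrincipalIdealRing.of_surjective ψ.symm.toRingHom ψ.symm.surjective
  have hD : discr K = 1 := by rw [discr_eq_discr_of_ringEquiv K e, Rat.numberField_discr]
  have hw : (torsionOrder K : ℂ) ≠ 0 := Nat.cast_ne_zero.2 (torsionOrder_ne_zero K)
  have hM := mellin_theta_ringOfIntegers hr (f := theta) one_pos two_ne_zero (fun t ht => by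
    rw [← ψ.symm.toEquiv.hasSum_iff]
    convert! hasSum_theta ht using 2 with n
    simp [absNorm_span_of_equiv_int ψ]) hs
  -- Replacing t by t² moves the Mellin variable to s/2 at the cost of a factor 1/2, which matches
  -- the 2^{r₁} in c_K.
  have hC := mellin_comp_rpow (fun t => (theta t : ℂ) - 1) s 2
  simp only [abs_two, Complex.real_smul] at hC
  push_cast at hC hM
  rw [hC, hM, completedZeta, cConst, hr1, hr2, hD, regulator_eq_one_of_rank_eq_zero hr,
    classNumber_eq_one_iff.2 hpid, Complex.Gammaℝ_def]
  simp only [abs_one, Int.cast_one, Complex.one_cpow]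
  push_cast
  rw [show -s / 2 = -(s / 2) by ring]
  field_simp

end Rational

/-! ### The fields ℚ(√-1) and ℚ(√-2). -/

section ImaginaryQuadratic

variable {K : Type*} [Field K] [NumberField K]

theorem exists_rat_add_rat_mul {d : ℤ} {x : K} (hx : x ^ 2 = ((-d : ℤ) : K)) (hK : ℚ⟮x⟯ = ⊤)
    (α : K) : ∃ a b : ℚ, α = a + b * x := by
  have hmem : α ∈ Algebra.adjoin ℚ {x} := by
    rw [← IntermediateField.adjoin_simple_toSubalgebra_of_isAlgebraic
      (Algebra.IsAlgebraic.isAlgebraic x), hK]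
    trivial
  have hx' : x ^ 2 = -(d : K) := by rw [hx]; push_cast; ring
  induction hmem using Algebra.adjoin_induction with
  | mem y hy => exact ⟨0, 1, by rw [Set.mem_singleton_iff.1 hy]; simp⟩
  | algebraMap r => exact ⟨r, 0, by simp⟩
  | add y z _ _ hy hz =>
    obtain ⟨a, b, rfl⟩ := hy
    obtain ⟨a', b', rfl⟩ := hz
    exact ⟨a + a', b + b', by push_cast; ring⟩
  | mul y z _ _ hy hz =>
    obtain ⟨a, b, rfl⟩ := hy
    obtain ⟨a', b', rfl⟩ := hz
    exact ⟨a * a' - d * b * b', a * b' + a' * b, by push_cast; linear_combination b * b' * hx'⟩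

/-- A rational number that is integral as a complex number is an integer. -/
theorem exists_int_of_isIntegral_ratCast {q : ℚ} (h : IsIntegral ℤ (q : ℂ)) : ∃ n : ℤ, q = n := by
  have h' : IsIntegral ℤ q :=
    (isIntegral_algebraMap_iff (algebraMap ℚ ℂ).injective).1 (by simpa using h)
  obtain ⟨n, hn⟩ := IsIntegrallyClosed.isIntegral_iff.1 h'
  exact ⟨n, by simpa using hn.symm⟩

/-- The image of x squares to a negative real, so it is purely imaginary. Complex conjugation can
thus replace the Galois conjugation of K. -/
theorem embedding_sqrt_conj {d : ℤ} (hd : 0 < d) {x : K} (hx : x ^ 2 = ((-d : ℤ) : K))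
    (φ : K →+* ℂ) : (starRingEnd ℂ) (φ x) = -φ x := by
  have h : φ x ^ 2 = -(d : ℂ) := by rw [← map_pow, hx]; simp
  have hre := congrArg Complex.re h
  have him := congrArg Complex.im h
  rw [pow_two] at hre him
  simp only [Complex.mul_re, Complex.mul_im, Complex.neg_re, Complex.neg_im, Complex.intCast_re,
    Complex.intCast_im] at hre him
  have hd' : (0 : ℝ) < d := Int.cast_pos.2 hd
  have him0 : (φ x).im ≠ 0 := by
    intro h0
    rw [h0] at hre
    nlinarith [mul_self_nonneg (φ x).re]
  have hre0 : (φ x).re = 0 := by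
    have : (φ x).re * (φ x).im = 0 := by linarith
    exact (mul_eq_zero.1 this).resolve_right him0
  exact Complex.ext (by simp [hre0]) (by simp)

/-- For `d = 1, 2`, an element `a + b √(-d)` is integral only if `a` and `b` are integers. -/
theorem exists_int_of_isIntegral {d : ℤ} (hd : d = 1 ∨ d = 2) {x : K}
    (hx : x ^ 2 = ((-d : ℤ) : K)) {a b : ℚ} (h : IsIntegral ℤ ((a : K) + b * x)) :
    ∃ m n : ℤ, a = m ∧ b = n := by
  have hd0 : 0 < d := by omega
  obtain ⟨φ⟩ : Nonempty (K →+* ℂ) := inferInstance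
  have hx2 : φ x ^ 2 = -(d : ℂ) := by rw [← map_pow, hx]; simp
  have h1 : IsIntegral ℤ ((a : ℂ) + b * φ x) := by simpa using map_isIntegral_int φ h
  have h2 : IsIntegral ℤ ((a : ℂ) - b * φ x) := by
    simpa [embedding_sqrt_conj hd0 hx, sub_eq_add_neg] using
      map_isIntegral_int (starRingEnd ℂ) h1
  -- A is the trace, B the norm, and M = 2db is integral because its square is d(4B - A²). Parity of
  -- A and M then decides.
  obtain ⟨A, hA⟩ := exists_int_of_isIntegral_ratCast (q := 2 * a) (by
    have h3 := h1.add h2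
    rwa [show (a : ℂ) + b * φ x + (a - b * φ x) = ((2 * a : ℚ) : ℂ) by push_cast; ring] at h3)
  obtain ⟨B, hB⟩ := exists_int_of_isIntegral_ratCast (q := a ^ 2 + d * b ^ 2) (by
    have h3 := h1.mul h2
    rwa [show ((a : ℂ) + b * φ x) * (a - b * φ x) = ((a ^ 2 + d * b ^ 2 : ℚ) : ℂ) by
      push_cast; linear_combination (-(b : ℂ) ^ 2) * hx2] at h3)
  obtain ⟨M, hM⟩ := exists_int_of_isIntegral_ratCast (q := d * (2 * b)) (by
    refine IsIntegral.of_pow two_pos ?_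
    have h3 := isIntegral_algebraMap (R := ℤ) (A := ℂ) (x := d * (4 * B - A ^ 2))
    have hq : (d * (2 * b)) ^ 2 = ((d * (4 * B - A ^ 2) : ℤ) : ℚ) := by
      push_cast
      rw [← hA, ← hB]
      ring
    rw [← Rat.cast_pow, hq]
    simpa using h3)
  have hrel : M ^ 2 = d * (4 * B - A ^ 2) := by
    have : (M : ℚ) ^ 2 = d * (4 * B - A ^ 2) := by rw [← hM, ← hA, ← hB]; ring
    exact_mod_cast this
  rcases hd with rfl | rfl
  · have hev : Even A ∧ Even M := by
      -- A² + M² = 4B excludes odd values modulo 4.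
      rcases Int.even_or_odd' A with ⟨k, rfl | rfl⟩ <;> rcases Int.even_or_odd' M with ⟨l, rfl | rfl⟩
      · simp
      all_goals ring_nf at hrel; omega
    obtain ⟨⟨k, rfl⟩, l, rfl⟩ := hev
    refine ⟨k, l, ?_, ?_⟩ <;> push_cast at hA hM <;> linarith
  -- Here M = 4b, so divisibility by 4 is needed: a descent through M, A and M/2 gives it.
  · have hM2 : Even M := by
      have : Even (M ^ 2) := ⟨4 * B - A ^ 2, by linarith⟩
      exact (Int.even_pow.1 this).1
    obtain ⟨l, rfl⟩ := hM2
    have hA2 : Even A := by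
      have : Even (A ^ 2) := ⟨2 * B - l ^ 2, by linarith⟩
      exact (Int.even_pow.1 this).1
    obtain ⟨k, rfl⟩ := hA2
    have hl2 : Even l := by
      have : Even (l ^ 2) := ⟨B - k ^ 2, by linarith⟩
      exact (Int.even_pow.1 this).1
    obtain ⟨j, rfl⟩ := hl2
    refine ⟨k, j, ?_, ?_⟩ <;> push_cast at hA hM <;> linarith

/-- For `d = 1, 2`, the ring of integers of `ℚ(√(-d))` is `ℤ[√(-d)]`. -/
theorem nonempty_algEquiv_ringOfIntegers {d : ℤ} (hd : d = 1 ∨ d = 2)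
    (hK : IsRatAdjoinSqrt K (-d)) : Nonempty (QuadraticAlgebra ℤ (-d) 0 ≃ₐ[ℤ] 𝓞 K) := by
  obtain ⟨x, hx, hgen⟩ := hK
  have hd0 : 0 < d := by omega
  have hxint : IsIntegral ℤ x := by
    refine IsIntegral.of_pow two_pos ?_
    rw [hx]
    exact isIntegral_algebraMap (R := ℤ) (A := K) (x := -d)
  obtain ⟨X, rfl⟩ : ∃ X : 𝓞 K, (X : K) = x := ⟨⟨x, hxint⟩, rfl⟩
  have hX : X * X = (-d) • (1 : 𝓞 K) + (0 : ℤ) • X := by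
    apply FaithfulSMul.algebraMap_injective (𝓞 K) K
    rw [map_mul, ← pow_two, hx]
    simp
  let F : QuadraticAlgebra ℤ (-d) 0 →ₐ[ℤ] 𝓞 K := QuadraticAlgebra.lift ⟨X, hX⟩
  have hF : ∀ z, ((F z : 𝓞 K) : K) = (z.re : K) + z.im * X := fun z => by
    simp [F, QuadraticAlgebra.lift]
  refine ⟨AlgEquiv.ofBijective F ⟨?_, fun α => ?_⟩⟩
  · rw [injective_iff_map_eq_zero]
    intro z hz
    have h0 : (z.re : K) + z.im * X = 0 := by rw [← hF, hz]; simp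
    have hx' : (X : K) ^ 2 = -(d : K) := by rw [hx]; push_cast; ring
    have h1 : z.re ^ 2 + d * z.im ^ 2 = 0 := by
      have : (z.re : K) ^ 2 + d * (z.im : K) ^ 2 = 0 := by
        linear_combination ((z.re : K) - z.im * X) * h0 + (z.im : K) ^ 2 * hx'
      exact_mod_cast this
    have him : z.im = 0 := by nlinarith [sq_nonneg z.re, sq_nonneg z.im]
    have hre : z.re = 0 := by rw [him] at h1; nlinarith
    exact QuadraticAlgebra.ext hre him
  · obtain ⟨a, b, hab⟩ := exists_rat_add_rat_mul hx hgen (α : K)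
    have hint : IsIntegral ℤ ((a : K) + b * X) := hab ▸ RingOfIntegers.isIntegral_coe α
    obtain ⟨m, n, rfl, rfl⟩ := exists_int_of_isIntegral hd hx hint
    refine ⟨⟨m, n⟩, RingOfIntegers.ext ?_⟩
    rw [hF, hab]
    simp

theorem algebraNorm_quadraticAlgebra {a b : ℤ} (z : QuadraticAlgebra ℤ a b) :
    Algebra.norm ℤ z = z.norm := by
  rw [← QuadraticAlgebra.det_toLinearMap_eq_norm, Algebra.norm_apply]
  rfl

theorem absNorm_span_of_algEquiv {d : ℤ} (hd : 0 < d)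
    (e : QuadraticAlgebra ℤ (-d) 0 ≃ₐ[ℤ] 𝓞 K) (z : QuadraticAlgebra ℤ (-d) 0) :
    (Ideal.absNorm (Ideal.span {e z}) : ℝ) = (z.re : ℝ) ^ 2 + d * (z.im : ℝ) ^ 2 := by
  rw [Ideal.absNorm_span_singleton, Algebra.norm_eq_of_algEquiv, algebraNorm_quadraticAlgebra,
    QuadraticAlgebra.norm_def, Nat.cast_natAbs,
    abs_of_nonneg (by nlinarith [mul_self_nonneg z.re, mul_self_nonneg z.im])]
  push_cast
  ring

theorem discr_of_algEquiv {d : ℤ} (e : QuadraticAlgebra ℤ (-d) 0 ≃ₐ[ℤ] 𝓞 K) :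
    discr K = -4 * d := by
  let b := (QuadraticAlgebra.basis (-d) (0 : ℤ)).map e.toLinearEquiv
  have hb : ⇑b = e ∘ QuadraticAlgebra.basis (-d) (0 : ℤ) := by ext; simp [b]
  rw [← discr_eq_discr K b, hb, ← Algebra.discr_eq_discr_of_algEquiv, Algebra.discr_def,
    Matrix.det_fin_two]
  simp only [Algebra.traceMatrix_apply, Algebra.traceForm_apply,
    Algebra.trace_eq_matrix_trace (QuadraticAlgebra.basis (-d) (0 : ℤ)), Matrix.trace_fin_two,
    Algebra.leftMulMatrix_eq_repr_mul, QuadraticAlgebra.basis_repr_apply]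
  have h0 : QuadraticAlgebra.basis (-d) (0 : ℤ) 0 = ⟨1, 0⟩ := by
    apply (QuadraticAlgebra.basis (-d) (0 : ℤ)).repr.injective
    ext i; fin_cases i <;> simp
  have h1 : QuadraticAlgebra.basis (-d) (0 : ℤ) 1 = ⟨0, 1⟩ := by
    apply (QuadraticAlgebra.basis (-d) (0 : ℤ)).repr.injective
    ext i; fin_cases i <;> simp
  simp [h0, h1]
  ring

theorem nrRealPlaces_eq_zero_of_sqrt {d : ℤ} (hd : 0 < d) (hK : IsRatAdjoinSqrt K (-d)) :
    nrRealPlaces K = 0 := by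
  obtain ⟨x, hx, -⟩ := hK
  classical
  refine Fintype.card_eq_zero_iff.2 ⟨fun ⟨w, hw⟩ => ?_⟩
  have h : embedding_of_isReal hw x ^ 2 = -(d : ℝ) := by rw [← map_pow, hx]; simp
  have hd' : (0 : ℝ) < d := Int.cast_pos.2 hd
  nlinarith [sq_nonneg (embedding_of_isReal hw x)]

theorem xi_and_li_of_imaginaryQuadratic {d : ℤ} (hd : d = 1 ∨ d = 2)
    (hK : IsRatAdjoinSqrt K (-d)) :
    IsDedekindXi K (dedekindXi K) ∧
      ((liCoeff K 1).im = 0 ∧ 0 < (liCoeff K 1).re) ∧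
      ((liCoeff K 2).im = 0 ∧ 0 < (liCoeff K 2).re) := by
  have hd0 : 0 < d := by omega
  have hdR : (0 : ℝ) < d := Int.cast_pos.2 hd0
  have hd2 : (d : ℝ) ≤ 2 := by exact_mod_cast (by omega : d ≤ 2)
  have hd1 : (1 : ℝ) ≤ d := by exact_mod_cast (by omega : 1 ≤ d)
  set r : ℝ := √d with hr_def
  have hr0 : 0 < r := Real.sqrt_pos.2 hdR
  have hrr : r ^ 2 = d := Real.sq_sqrt hdR.le
  have hr1 : 1 ≤ r := by nlinarith
  obtain ⟨e⟩ := nonempty_algEquiv_ringOfIntegers hd hK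
  have hfin : Module.finrank ℚ K = 2 := by
    rw [← RingOfIntegers.rank, ← e.toLinearEquiv.finrank_eq, QuadraticAlgebra.finrank_eq_two]
  have hreal := nrRealPlaces_eq_zero_of_sqrt hd0 hK
  have hcomplex : nrComplexPlaces K = 1 := by
    have := card_add_two_mul_card_eq_rank K
    omega
  have hrank : rank K = 0 := rank_eq_zero_of_card (by rw [hreal, hcomplex])
  have hD : |discr K| = 4 * d := by
    rw [discr_of_algEquiv e, abs_of_nonpos (by linarith)]
    ring
  have hpid : IsPrincipalIdealRing (𝓞 K) := by
    -- The Minkowski criterion asks for |D| < π², and |D| = 4d ≤ 8.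
    apply RingOfIntegers.isPrincipalIdealRing_of_abs_discr_lt
    rw [hD, hcomplex, hfin]
    have := Real.pi_gt_three
    push_cast
    norm_num [Nat.factorial]
    nlinarith
  -- Dividing the norm form m² + d n² by r = √d makes the two scalings r⁻¹ and r reciprocal, hence
  -- the kernel self-dual.
  have hker : IsThetaKernel fun t => theta (r⁻¹ * t) * theta (r * t) := by
    refine isThetaKernel_theta_mul_theta ?_ (by linarith) (inv_mul_cancel₀ hr0.ne')
    rw [← one_div, le_div_iff₀ hr0]
    nlinarith
  refine xi_and_li_of_thetaKernel hker fun s hs => ?_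
  have hw : (torsionOrder K : ℂ) ≠ 0 := Nat.cast_ne_zero.2 (torsionOrder_ne_zero K)
  let ψ : ℤ × ℤ ≃ 𝓞 K :=
    { toFun := fun p => (⟨p.1, p.2⟩ : QuadraticAlgebra ℤ (-d) 0)
      invFun := fun z => (z.re, z.im)
      left_inv := fun _ => rfl
      right_inv := fun _ => rfl : ℤ × ℤ ≃ QuadraticAlgebra ℤ (-d) 0 }.trans e.toEquiv
  have hψ : ∀ p, (Ideal.absNorm (Ideal.span {ψ p}) : ℝ) = (p.1 : ℝ) ^ 2 + d * (p.2 : ℝ) ^ 2 :=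
    fun p => absNorm_span_of_algEquiv hd0 e _
  have hM := mellin_theta_ringOfIntegers hrank (f := fun t => theta (r⁻¹ * t) * theta (r * t))
    hr0 one_ne_zero (fun t ht => by
      rw [← ψ.hasSum_iff]
      have h1 := hasSum_theta (show 0 < r⁻¹ * t by positivity)
      have h2 := hasSum_theta (show 0 < r * t by positivity)
      convert! h1.mul h2 (h1.summable.mul_of_nonneg h2.summable (fun _ => (Real.exp_pos _).le)
        (fun _ => (Real.exp_pos _).le)) using 2 with p
      rw [Function.comp_apply, hψ, ← Real.exp_add, ← hrr]
      congr 1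
      field_simp
      ring) hs
  -- |D| = (2r)²: the factor r^s is the scaling of the kernel, and 2^s cancels against (2π)^(1-s).
  have hpow : ((4 * d : ℤ) : ℂ) ^ (s / 2) = 2 ^ s * (r : ℂ) ^ s := by
    have h0 : (2 * r : ℝ) * (2 * r) = (4 * d : ℤ) := by push_cast; rw [← hrr]; ring
    have h1 : ((4 * d : ℤ) : ℂ) = ((2 * r : ℝ) : ℂ) * ((2 * r : ℝ) : ℂ) := by
      rw [← Complex.ofReal_mul, h0, Complex.ofReal_intCast]
    have h2 := Complex.mul_cpow_ofReal_nonneg (a := 2) (b := r) (by norm_num) hr0.le s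
    have h3 : ((2 * r : ℝ) : ℂ) ≠ 0 := Complex.ofReal_ne_zero.2 (by positivity)
    rw [h1, Complex.mul_cpow_ofReal_nonneg (by positivity) (by positivity),
      ← Complex.cpow_add _ _ h3, add_halves]
    simpa using h2
  simp only [Nat.cast_one, div_one] at hM
  push_cast at hM
  push_cast
  rw [hM, completedZeta, cConst, hreal, hcomplex, hD, hpow, regulator_eq_one_of_rank_eq_zero hrank,
    classNumber_eq_one_iff.2 hpid, GammaC]
  have h2pi : (2 * (Real.pi : ℂ)) ^ (1 - s) =
      2 * Real.pi * ((2 : ℂ) ^ s)⁻¹ * (Real.pi : ℂ) ^ (-s) := by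
    have h2 := Complex.mul_cpow_ofReal_nonneg (a := 2) (b := Real.pi) (by norm_num)
      Real.pi_pos.le (-s)
    push_cast at h2
    have hne : (2 * (Real.pi : ℂ)) ≠ 0 := by simp [Real.pi_ne_zero]
    rw [sub_eq_add_neg, Complex.cpow_add _ _ hne, h2, Complex.cpow_one, Complex.cpow_neg 2]
    ring
  have h2s : (2 : ℂ) ^ s ≠ 0 := by simp [Complex.cpow_eq_zero_iff]
  have hpi : (Real.pi : ℂ) ≠ 0 := by simp [Real.pi_ne_zero]
  rw [h2pi]
  push_cast
  field_simp

end ImaginaryQuadratic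

end DedekindLi

theorem mainTheorem2 (K : Type*) [Field K] [NumberField K]
    (hK : Nonempty (K ≃+* ℚ) ∨ DedekindLi.IsRatAdjoinSqrt K (-1) ∨
      DedekindLi.IsRatAdjoinSqrt K (-2)) :
    DedekindLi.IsDedekindXi K (DedekindLi.dedekindXi K) ∧
      ((DedekindLi.liCoeff K 1).im = 0 ∧ 0 < (DedekindLi.liCoeff K 1).re) ∧
      ((DedekindLi.liCoeff K 2).im = 0 ∧ 0 < (DedekindLi.liCoeff K 2).re) := by
  rcases hK with ⟨⟨e⟩⟩ | h | h
  · exact DedekindLi.xi_and_li_of_equiv_rat e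
  · exact DedekindLi.xi_and_li_of_imaginaryQuadratic (Or.inl rfl) h
  · exact DedekindLi.xi_and_li_of_imaginaryQuadratic (Or.inr rfl) h
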